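/- Let $n\ge 2$ and $d\ge 1$ be integers such that $\exp\big(nd\log^{-7}n\big)\le 2^{\binom n2}$, i.e. such that the bound below does not exceed the total number of graphs on the vertex set $[n]=\{1,\dots,n\}$ (equivalently, $d\le \frac{\ln 2}{2}(n-1)\log^7 n$; here $\log$ is the natural logarithm and $\log^{-7}n=(\log n)^{-7}$). Call a (labelled, simple) graph $G$ on $[n]$ an intersection graph of unit spheres in dimension $d$ if there are points $c_1,\dots,c_n\in\mathbb{R}^d$ such that distinct $i,j\in[n]$ are adjacent in $G$ if and only if the Euclidean spheres of radius $1$ centred at $c_i$ and $c_j$ intersect. Then the number of graphs on $[n]$ which can be realized as intersection graphs of unit spheres in dimension $d$ is at least $$\exp\big(nd\log^{-7} n\big).$$ -/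

import Mathlib

/-- The intersection graph of the unit spheres in `ℝ^d` with centres `c 0, …, c (n - 1)`: its
vertex set is `Fin n`, and distinct vertices `i`, `j` are adjacent exactly when the spheres of
radius `1` around `c i` and `c j` have a common point. -/
def unitSphereIntersectionGraph {n d : ℕ} (c : Fin n → EuclideanSpace ℝ (Fin d)) :
    SimpleGraph (Fin n) where
  Adj i j := i ≠ j ∧ (Metric.sphere (c i) 1 ∩ Metric.sphere (c j) 1).Nonempty
  symm := ⟨fun _ _ h => ⟨h.1.symm, Set.inter_comm _ _ ▸ h.2⟩⟩
  loopless := ⟨fun _ h => h.1 rfl⟩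

/-- The set of (labelled) graphs on the vertex set `Fin n` that can be realized as intersection
graphs of unit spheres in dimension `d`. -/
def unitSphereGraphs (n d : ℕ) : Set (SimpleGraph (Fin n)) :=
  {G | ∃ c : Fin n → EuclideanSpace ℝ (Fin d), G = unitSphereIntersectionGraph c}

/-! ### When two unit spheres meet -/

/-! For `d < n`, split the vertices into parts of sizes `k ≤ d` and `m`. Centres `√3 eᵢ` on one side
and vectors with coordinates `±1/√d` on the other realize every bipartite pattern across the split,
since the squared distance is `4 ∓ 2√3/√d`. This gives `2 ^ (k * m)` graphs, and a suitable split
has `n * d ≤ 4 * k * m`. For `n ≥ 4` the factor `log⁷ n · log 2 ≥ 4` absorbs the loss. For `d ≥ n ≥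
2` every graph is realizable, so the hypothesis is the claim. Dimension one and `n ≤ 3` are treated
by hand. -/

lemma exists_unit_orthogonal {d : ℕ} (hd : 2 ≤ d) (v : EuclideanSpace ℝ (Fin d)) :
    ∃ u : EuclideanSpace ℝ (Fin d), ‖u‖ = 1 ∧ inner ℝ v u = 0 := by
  have hpos : 0 < Module.finrank ℝ (ℝ ∙ v)ᗮ := by
    have h1 := (ℝ ∙ v).finrank_add_finrank_orthogonal
    have h2 : Module.finrank ℝ (ℝ ∙ v) ≤ 1 := by
      simpa using finrank_span_le_card (R := ℝ) ({v} : Set (EuclideanSpace ℝ (Fin d)))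
    rw [finrank_euclideanSpace_fin] at h1
    omega
  have : Nontrivial (ℝ ∙ v)ᗮ := Module.finrank_pos_iff.mp hpos
  obtain ⟨u, hu⟩ := exists_norm_eq (ℝ ∙ v)ᗮ zero_le_one
  exact ⟨u, hu, Submodule.mem_orthogonal_singleton_iff_inner_right.mp u.2⟩

lemma unit_spheres_inter_nonempty_iff {d : ℕ} (hd : 2 ≤ d) (x y : EuclideanSpace ℝ (Fin d)) :
    (Metric.sphere x 1 ∩ Metric.sphere y 1).Nonempty ↔ ‖x - y‖ ^ 2 ≤ 4 := by
  constructor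
  · rintro ⟨z, hx, hy⟩
    rw [Metric.mem_sphere] at hx hy
    have h : ‖x - y‖ ≤ 2 := by
      rw [← dist_eq_norm]
      linarith [dist_triangle_left x y z]
    nlinarith [norm_nonneg (x - y)]
  · intro h
    obtain ⟨u, hu, hxy⟩ := exists_unit_orthogonal hd (x - y)
    -- Chosen so that the midpoint of `x` and `y` shifted by `t • u` is at distance 1 from both.
    set t := Real.sqrt (1 - ‖x - y‖ ^ 2 / 4) with ht
    have ht2 : t ^ 2 = 1 - ‖x - y‖ ^ 2 / 4 := Real.sq_sqrt (by linarith)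
    have key : ∀ a : ℝ, a ^ 2 = 1 / 4 → ‖a • (x - y) + t • u‖ = 1 := by
      intro a ha
      have : ‖a • (x - y) + t • u‖ ^ 2 = 1 := by
        rw [norm_add_sq_real, inner_smul_left, inner_smul_right, hxy, norm_smul, norm_smul,
          mul_pow, mul_pow, hu, Real.norm_eq_abs, Real.norm_eq_abs, sq_abs, sq_abs, ha, ht2]
        simp only [mul_zero]
        ring
      nlinarith [norm_nonneg (a • (x - y) + t • u)]
    refine ⟨(1 / 2 : ℝ) • (x + y) + t • u, ?_, ?_⟩
    · rw [mem_sphere_iff_norm]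
      convert key (-1 / 2) (by norm_num) using 1
      congr 1
      module
    · rw [mem_sphere_iff_norm]
      convert key (1 / 2) (by norm_num) using 1
      congr 1
      module

lemma unitSphereIntersectionGraph_adj {n d : ℕ} (hd : 2 ≤ d)
    (c : Fin n → EuclideanSpace ℝ (Fin d)) (i j : Fin n) :
    (unitSphereIntersectionGraph c).Adj i j ↔ i ≠ j ∧ ‖c i - c j‖ ^ 2 ≤ 4 :=
  and_congr_right fun _ => unit_spheres_inter_nonempty_iff hd _ _

/-! ### All graphs are realizable when the dimension is at least the number of vertices -/

lemma two_pow_choose_le_ncard_univ (n : ℕ) :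
    2 ^ n.choose 2 ≤ (Set.univ : Set (SimpleGraph (Fin n))).ncard := by
  classical
  have hinj : Function.Injective
      (fun s : Set ((Sym2.diagSet : Set (Sym2 (Fin n)))ᶜ : Set (Sym2 (Fin n))) =>
        SimpleGraph.fromEdgeSet (Subtype.val '' s)) := by
    intro s t h
    have h' := congrArg SimpleGraph.edgeSet h
    simp only [SimpleGraph.edgeSet_fromEdgeSet] at h'
    have hd : ∀ s : Set ((Sym2.diagSet : Set (Sym2 (Fin n)))ᶜ : Set (Sym2 (Fin n))),
        Subtype.val '' s \ Sym2.diagSet = Subtype.val '' s := by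
      intro s
      rw [sdiff_eq_left, Set.disjoint_left]
      rintro _ ⟨a, -, rfl⟩
      exact a.2
    rw [hd, hd] at h'
    exact Subtype.val_injective.image_injective h'
  have hcard := Nat.card_le_card_of_injective _ hinj
  rw [Nat.card_eq_fintype_card, Fintype.card_set, Sym2.card_diagSet_compl, Fintype.card_fin] at hcard
  rwa [Set.ncard_univ]

lemma Orthonormal.norm_sub_sq_of_combination {ι E : Type*} [Fintype ι] [NormedAddCommGroup E]
    [InnerProductSpace ℝ E] {B : ι → E} (hB : Orthonormal ℝ B) (a b : ι → ℝ) :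
    ‖∑ l, a l • B l - ∑ l, b l • B l‖ ^ 2
      = ∑ l, a l ^ 2 + ∑ l, b l ^ 2 - 2 * ∑ l, a l * b l := by
  rw [norm_sub_sq_real, ← real_inner_self_eq_norm_sq, ← real_inner_self_eq_norm_sq,
    hB.inner_sum, hB.inner_sum, hB.inner_sum]
  simp [pow_two]
  ring

/-- The centres are rows of a matrix with diagonal `r` and off-diagonal entries `±ε` encoding
adjacency. Rows have squared norm 2, so adjacency means nonnegative inner product; that product is
`±2rε` up to an error `nε² < 2rε`. -/
lemma unitSphereGraphs_eq_univ {n d : ℕ} (hd : 2 ≤ d) (hnd : n ≤ d) :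
    unitSphereGraphs n d = Set.univ := by
  classical
  rw [Set.eq_univ_iff_forall]
  intro G
  rcases Nat.eq_zero_or_pos n with rfl | hn
  · exact ⟨fun _ => 0, Subsingleton.elim _ _⟩
  have hn1 : (1 : ℝ) ≤ n := by exact_mod_cast hn
  obtain ⟨ε, r, hε, hr, hnorm, hdom⟩ : ∃ ε r : ℝ, 0 < ε ∧ 0 < r ∧
      r ^ 2 + (n - 1) * ε ^ 2 = 2 ∧ n * ε < 2 * r := by
    have hb : ((n : ℝ) - 1) * (1 / n) ^ 2 ≤ 1 := by
      rw [one_div, inv_pow, ← div_eq_mul_inv, div_le_one (by positivity)]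
      nlinarith
    have hr : 1 ≤ Real.sqrt (2 - (n - 1) * (1 / n) ^ 2) := Real.one_le_sqrt.mpr (by linarith)
    refine ⟨1 / n, Real.sqrt (2 - (n - 1) * (1 / n) ^ 2), by positivity, by linarith, ?_, ?_⟩
    · rw [Real.sq_sqrt (by linarith)]
      ring
    · rw [mul_one_div_cancel (by positivity)]
      linarith
  let M : Fin n → Fin n → ℝ := fun i l => if i = l then r else if G.Adj i l then ε else -ε
  have hMd : ∀ i, M i i = r := fun i => by simp [M]
  have hMo : ∀ i l, i ≠ l → M i l = if G.Adj i l then ε else -ε := fun i l h => by simp [M, h]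
  have hMabs : ∀ i l, i ≠ l → |M i l| = ε := fun i l h => by
    rw [hMo i l h]
    split_ifs <;> simp [abs_of_pos hε]
  have hself : ∀ i, ∑ l, M i l ^ 2 = 2 := by
    intro i
    rw [← Finset.add_sum_erase _ _ (Finset.mem_univ i), hMd,
      Finset.sum_congr rfl (g := fun _ => ε ^ 2), Finset.sum_const,
      Finset.card_erase_of_mem (Finset.mem_univ i), Finset.card_univ, Fintype.card_fin,
      nsmul_eq_mul, Nat.cast_pred hn, hnorm]
    intro l hl
    rw [← sq_abs, hMabs i l (Finset.ne_of_mem_erase hl).symm]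
  have hcross : ∀ i j, i ≠ j → |∑ l, M i l * M j l - 2 * r * M i j| ≤ n * ε ^ 2 := by
    intro i j hij
    have hsymm : M j i = M i j := by rw [hMo _ _ hij, hMo _ _ hij.symm, G.adj_comm]
    have hsplit : ∑ l, M i l * M j l - 2 * r * M i j
        = ∑ l ∈ ({i, j} : Finset (Fin n))ᶜ, M i l * M j l := by
      rw [← Finset.sum_add_sum_compl {i, j}, Finset.sum_pair hij, hMd, hMd, hsymm]
      ring
    rw [hsplit]
    calc |∑ l ∈ ({i, j} : Finset (Fin n))ᶜ, M i l * M j l|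
        ≤ ∑ l ∈ ({i, j} : Finset (Fin n))ᶜ, |M i l * M j l| := Finset.abs_sum_le_sum_abs _ _
      _ = ∑ l ∈ ({i, j} : Finset (Fin n))ᶜ, ε ^ 2 := by
          refine Finset.sum_congr rfl fun l hl => ?_
          simp only [Finset.mem_compl, Finset.mem_insert, Finset.mem_singleton, not_or] at hl
          rw [abs_mul, hMabs i l (Ne.symm hl.1), hMabs j l (Ne.symm hl.2), pow_two]
      _ ≤ n * ε ^ 2 := by
          rw [Finset.sum_const, nsmul_eq_mul]
          gcongr
          simpa using Finset.card_le_univ ({i, j} : Finset (Fin n))ᶜ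
  let B : Fin n → EuclideanSpace ℝ (Fin d) := EuclideanSpace.basisFun (Fin d) ℝ ∘ Fin.castLE hnd
  have hB : Orthonormal ℝ B :=
    (EuclideanSpace.basisFun (Fin d) ℝ).orthonormal.comp _ (Fin.castLE_injective hnd)
  refine ⟨fun i => ∑ l, M i l • B l, ?_⟩
  ext i j
  rw [unitSphereIntersectionGraph_adj hd, hB.norm_sub_sq_of_combination, hself, hself]
  rcases eq_or_ne i j with rfl | hij
  · simp
  have hc := abs_le.mp (hcross i j hij)
  have hlt : n * ε ^ 2 < 2 * r * ε := by nlinarith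
  by_cases hG : G.Adj i j
  · rw [hMo i j hij, if_pos hG] at hc
    simp only [hG, ne_eq, hij, not_false_eq_true, true_and, true_iff]
    linarith
  · rw [hMo i j hij, if_neg hG] at hc
    simp only [hG, false_iff, not_and, not_le]
    intro _
    linarith

/-! ### Prescribing the edges between two parts of the vertex set -/

/-- The edges across the split recover `s`; edges inside the parts may be arbitrary. -/
lemma two_pow_mul_le_ncard_of_bipartite {k m d : ℕ}
    (h : ∀ s : Fin k → Fin m → Bool, ∃ c : Fin (k + m) → EuclideanSpace ℝ (Fin d), ∀ i j,
      (unitSphereIntersectionGraph c).Adj (Fin.castAdd m i) (Fin.natAdd k j) ↔ s i j = true) :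
    2 ^ (k * m) ≤ (unitSphereGraphs (k + m) d).ncard := by
  choose c hc using h
  have hinj : Function.Injective
      (fun s => (⟨unitSphereIntersectionGraph (c s), c s, rfl⟩ : unitSphereGraphs (k + m) d)) := by
    intro s t hst
    have hg : unitSphereIntersectionGraph (c s) = unitSphereIntersectionGraph (c t) :=
      congrArg Subtype.val hst
    funext i j
    rw [Bool.eq_iff_iff, ← hc s, ← hc t, hg]
  have hcard := Nat.card_le_card_of_injective _ hinj
  rwa [Nat.card_eq_fintype_card, Fintype.card_fun, Fintype.card_fun, Fintype.card_bool,
    Fintype.card_fin, Fintype.card_fin, ← pow_mul, mul_comm, Nat.card_coe_set_eq] at hcard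

lemma two_pow_mul_le_ncard {k m d : ℕ} (hd : 2 ≤ d) (hk : k ≤ d) :
    2 ^ (k * m) ≤ (unitSphereGraphs (k + m) d).ncard := by
  classical
  refine two_pow_mul_le_ncard_of_bipartite fun s => ?_
  have hd0 : (0 : ℝ) < d := by exact_mod_cast (by omega : 0 < d)
  let ε : ℝ := (Real.sqrt d)⁻¹
  have hε : 0 < ε := inv_pos.mpr (Real.sqrt_pos.mpr hd0)
  have hr : (0 : ℝ) < Real.sqrt 3 := by positivity
  have hdε : d * ε ^ 2 = 1 := by
    rw [inv_pow, Real.sq_sqrt hd0.le, mul_inv_cancel₀ hd0.ne']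
  -- Coordinates not indexed by the first part are set to `-ε`, keeping the norm equal to 1.
  let x : Fin m → EuclideanSpace ℝ (Fin d) := fun j => WithLp.toLp 2 fun l =>
    if ∃ i, Fin.castLE hk i = l ∧ s i j = true then ε else -ε
  have hx : ∀ j, ‖x j‖ ^ 2 = 1 := by
    intro j
    rw [EuclideanSpace.real_norm_sq_eq, Finset.sum_congr rfl (g := fun _ => ε ^ 2)]
    · simpa using hdε
    · intro l _
      simp only [x]
      split_ifs <;> simp
  have hxs : ∀ i j, x j (Fin.castLE hk i) = if s i j = true then ε else -ε := by
    intro i j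
    simp [x, (Fin.castLE_injective hk).eq_iff]
  refine ⟨Fin.addCases (fun i => EuclideanSpace.single (Fin.castLE hk i) (Real.sqrt 3)) x, ?_⟩
  intro i j
  have hne : Fin.castAdd m i ≠ Fin.natAdd k j := by
    rw [Ne, Fin.ext_iff, Fin.val_castAdd, Fin.val_natAdd]
    omega
  rw [unitSphereIntersectionGraph_adj hd, Fin.addCases_left, Fin.addCases_right,
    norm_sub_sq_real, hx, PiLp.norm_single, EuclideanSpace.inner_single_left, hxs,
    Real.norm_eq_abs, sq_abs, Real.sq_sqrt (by norm_num)]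
  simp only [ne_eq, hne, not_false_eq_true, true_and, conj_trivial]
  have hpos := mul_pos hr hε
  cases s i j
  · simp only [Bool.false_eq_true, if_false, iff_false, not_le]
    linarith
  · simp only [if_true, iff_true]
    linarith

/-! ### Dimension one -/

lemma unit_spheres_inter_nonempty_iff_of_dim_one (a b : ℝ) :
    (Metric.sphere (EuclideanSpace.single (0 : Fin 1) a) 1 ∩
      Metric.sphere (EuclideanSpace.single (0 : Fin 1) b) 1).Nonempty ↔
        a = b ∨ a = b + 2 ∨ b = a + 2 := by
  have hmem : ∀ (z : EuclideanSpace ℝ (Fin 1)) (t : ℝ),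
      z ∈ Metric.sphere (EuclideanSpace.single (0 : Fin 1) t) 1 ↔ z 0 - t = 1 ∨ z 0 - t = -1 := by
    intro z t
    rw [mem_sphere_iff_norm, EuclideanSpace.norm_eq, Real.sqrt_eq_one]
    simp [pow_two, mul_self_eq_one_iff]
  constructor
  · rintro ⟨z, ha, hb⟩
    rw [hmem] at ha hb
    rcases ha with ha | ha <;> rcases hb with hb | hb
    · left; linarith
    · right; right; linarith
    · right; left; linarith
    · left; linarith
  · rintro (h | h | h)
    · exact ⟨EuclideanSpace.single 0 (a + 1), by rw [hmem]; simp, by rw [hmem]; simp [h]⟩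
    · refine ⟨EuclideanSpace.single 0 (b + 1), ?_, ?_⟩ <;> rw [hmem] <;> simp [h]
      norm_num
    · refine ⟨EuclideanSpace.single 0 (a + 1), ?_, ?_⟩ <;> rw [hmem] <;> simp [h]
      norm_num

lemma two_pow_le_ncard_of_dim_one (m : ℕ) :
    2 ^ (1 * m) ≤ (unitSphereGraphs (1 + m) 1).ncard := by
  refine two_pow_mul_le_ncard_of_bipartite fun s =>
    ⟨Fin.addCases (fun _ => EuclideanSpace.single 0 0)
      fun j => EuclideanSpace.single 0 (if s 0 j = true then 0 else 1), ?_⟩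
  intro i j
  have hne : Fin.castAdd m i ≠ Fin.natAdd 1 j := by
    rw [Ne, Fin.ext_iff, Fin.val_castAdd, Fin.val_natAdd]
    omega
  obtain rfl : i = 0 := Subsingleton.elim _ _
  simp only [unitSphereIntersectionGraph, Fin.addCases_left, Fin.addCases_right,
    unit_spheres_inter_nonempty_iff_of_dim_one, ne_eq, hne, not_false_eq_true, true_and]
  cases s 0 j <;> norm_num

lemma unitSphereGraphs_three_one : unitSphereGraphs 3 1 = Set.univ := by
  rw [Set.eq_univ_iff_forall]
  intro G
  suffices h : ∃ x y z : ℝ, (G.Adj 0 1 ↔ x = y ∨ x = y + 2 ∨ y = x + 2) ∧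
      (G.Adj 0 2 ↔ x = z ∨ x = z + 2 ∨ z = x + 2) ∧
      (G.Adj 1 2 ↔ y = z ∨ y = z + 2 ∨ z = y + 2) by
    obtain ⟨x, y, z, h01, h02, h12⟩ := h
    refine ⟨fun i => EuclideanSpace.single 0 (![x, y, z] i), ?_⟩
    have hcomm : ∀ H : SimpleGraph (Fin 3),
        (G.Adj 0 1 ↔ H.Adj 0 1) → (G.Adj 0 2 ↔ H.Adj 0 2) → (G.Adj 1 2 ↔ H.Adj 1 2) → G = H := by
      intro H h1 h2 h3
      ext i j
      fin_cases i <;> fin_cases j <;> simp [h1, h2, h3, G.adj_comm 1 0, G.adj_comm 2 0,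
        G.adj_comm 2 1, H.adj_comm 1 0, H.adj_comm 2 0, H.adj_comm 2 1]
    refine hcomm _ ?_ ?_ ?_ <;>
      simp [unitSphereIntersectionGraph, unit_spheres_inter_nonempty_iff_of_dim_one, h01, h02, h12]
  by_cases h01 : G.Adj 0 1 <;> by_cases h02 : G.Adj 0 2 <;> by_cases h12 : G.Adj 1 2 <;>
    simp only [h01, h02, h12, true_iff, false_iff]
  · exact ⟨0, 0, 0, by norm_num⟩
  · exact ⟨0, 2, -2, by norm_num⟩
  · exact ⟨2, 0, -2, by norm_num⟩
  · exact ⟨0, 0, 1, by norm_num⟩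
  · exact ⟨2, -2, 0, by norm_num⟩
  · exact ⟨0, 1, 0, by norm_num⟩
  · exact ⟨1, 0, 0, by norm_num⟩
  · exact ⟨0, 1, 5, by norm_num⟩

/-! ### The lower bound -/

lemma exists_two_pow_le_ncard {n d : ℕ} (hn : 2 ≤ n) (hd : 1 ≤ d) (hdn : d < n) :
    ∃ e, n * d ≤ 4 * e ∧ 2 ^ e ≤ (unitSphereGraphs n d).ncard := by
  rcases hd.eq_or_lt with rfl | hd
  · obtain ⟨m, rfl⟩ := Nat.exists_eq_add_of_le (by omega : 1 ≤ n)
    exact ⟨1 * m, by omega, two_pow_le_ncard_of_dim_one m⟩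
  · rcases le_total (2 * d) n with h | h
    · obtain ⟨m, rfl⟩ := Nat.exists_eq_add_of_le hdn.le
      exact ⟨d * m, by nlinarith, two_pow_mul_le_ncard hd le_rfl⟩
    -- A balanced split gives `4 * e ≥ n ^ 2 - 1 ≥ n * (n - 1) ≥ n * d`.
    · obtain ⟨m, hm⟩ := Nat.even_or_odd' n
      rcases hm with rfl | rfl
      · refine ⟨m * m, by nlinarith, ?_⟩
        rw [two_mul]
        exact two_pow_mul_le_ncard hd (by omega)
      · refine ⟨m * (m + 1), by nlinarith, ?_⟩
        rw [show 2 * m + 1 = m + (m + 1) by ring]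
        exact two_pow_mul_le_ncard hd (by omega)

lemma four_le_log_pow_mul_log_two {n : ℕ} (hn : 4 ≤ n) :
    4 ≤ Real.log n ^ 7 * Real.log 2 := by
  have h2 := Real.log_two_gt_d9
  have h4 : Real.log 4 = 2 * Real.log 2 := by
    rw [show (4 : ℝ) = 2 ^ 2 by norm_num, Real.log_pow]
    norm_num
  have hlog : 1.38 ≤ Real.log n := by
    have : Real.log 4 ≤ Real.log n := Real.log_le_log (by norm_num) (by exact_mod_cast hn)
    linarith
  calc (4 : ℝ) ≤ 1.38 ^ 7 * 0.69 := by norm_num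
    _ ≤ Real.log n ^ 7 * Real.log 2 := by gcongr; linarith

lemma exp_div_log_pow_le_two_pow_iff {n : ℕ} (hn : 2 ≤ n) (d e : ℕ) :
    Real.exp ((n : ℝ) * (d : ℝ) / Real.log (n : ℝ) ^ 7) ≤ (2 : ℝ) ^ e ↔
      (n : ℝ) * d ≤ e * (Real.log n ^ 7 * Real.log 2) := by
  have hL : 0 < Real.log n ^ 7 := pow_pos (Real.log_pos (by exact_mod_cast hn)) 7
  rw [← Real.le_log_iff_exp_le (by positivity), Real.log_pow, div_le_iff₀ hL]
  ring_nf

theorem theorem4 (n d : ℕ) (hn : 2 ≤ n) (hd : 1 ≤ d)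
    (hnd : Real.exp ((n : ℝ) * (d : ℝ) / Real.log (n : ℝ) ^ 7) ≤ (2 : ℝ) ^ (n.choose 2)) :
    Real.exp ((n : ℝ) * (d : ℝ) / Real.log (n : ℝ) ^ 7) ≤ ((unitSphereGraphs n d).ncard : ℝ) := by
  have hall : unitSphereGraphs n d = Set.univ →
      Real.exp ((n : ℝ) * (d : ℝ) / Real.log (n : ℝ) ^ 7) ≤
        ((unitSphereGraphs n d).ncard : ℝ) := by
    intro h
    rw [h]
    exact hnd.trans (by exact_mod_cast two_pow_choose_le_ncard_univ n)
  rcases le_or_gt n d with hle | hlt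
  · exact hall (unitSphereGraphs_eq_univ (hn.trans hle) hle)
  have h2 := Real.log_two_lt_d9
  have h2' := Real.log_two_gt_d9
  rcases (by omega : n = 2 ∨ n = 3 ∨ 4 ≤ n) with rfl | rfl | h4
  -- The hypothesis would give `2 * d ≤ log⁸ 2 < 1`.
  · exfalso
    rw [exp_div_log_pow_le_two_pow_iff le_rfl, Nat.choose_self] at hnd
    have hd' : (1 : ℝ) ≤ d := by exact_mod_cast hd
    have h7 : Real.log 2 ^ 7 ≤ 1 := pow_le_one₀ (by linarith) (by linarith)
    push_cast at hnd
    nlinarith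
  -- Here the hypothesis reads `d ≤ log⁷ 3 · log 2 < 2`.
  · have hd1 : d = 1 := by
      by_contra hne
      have hd' : (2 : ℝ) ≤ d := by exact_mod_cast (by omega : 2 ≤ d)
      rw [exp_div_log_pow_le_two_pow_iff hn, show Nat.choose 3 2 = 3 from rfl] at hnd
      have h3 := Real.log_three_lt_d9
      have h3' := Real.log_three_gt_d9
      push_cast at hnd
      have h7 : Real.log 3 ^ 7 ≤ 1.1 ^ 7 := by gcongr; linarith
      nlinarith
    subst hd1
    exact hall unitSphereGraphs_three_one
  · obtain ⟨e, he, hcard⟩ := exists_two_pow_le_ncard hn hd hlt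
    have hexp : Real.exp ((n : ℝ) * (d : ℝ) / Real.log (n : ℝ) ^ 7) ≤ (2 : ℝ) ^ e := by
      rw [exp_div_log_pow_le_two_pow_iff hn]
      have he' : (n : ℝ) * d ≤ 4 * e := by exact_mod_cast he
      nlinarith [four_le_log_pow_mul_log_two h4, (Nat.cast_nonneg e : (0 : ℝ) ≤ e)]
    exact hexp.trans (by exact_mod_cast hcard)
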